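/- **Setting.** Let $L,T,\delta>0$, $\mathcal O=(0,L)$ with periodic boundary conditions, $n\in(2,3)$, and let $g_k$, $k\in\mathbb Z$, be the $L^2(\mathcal O)$-orthonormal periodic Laplace eigenfunctions $g_k=\sqrt{2/L}\,\sin(2\pi kx/L)$ for $k>0$, $g_0=1/\sqrt L$, $g_k=\sqrt{2/L}\,\cos(2\pi kx/L)$ for $k<0$. Let $\lambda_k=\lambda_{-k}\ge0$ with $\sum_{k\in\mathbb Z}k^4\lambda_k^2<\infty$, put $C_{\mathrm{Strat}}=\frac12\frac{n^2}{4}\bigl(\frac{\lambda_0^2}{L}+\sum_{k\ge1}\frac{2\lambda_k^2}{L}\bigr)$, and let $S>C_{\mathrm{Strat}}\,\frac{3}{2^{n-4}}\,\frac{n-2}{3-n}$. Let $\Lambda^0$ be a Borel probability measure on $H^1_{\mathrm{per}}(\mathcal O)$ concentrated on nonnegative functions $v$ with $\int_{\mathcal O}\frac12|v_x|^2\,dx+\int_{\mathcal O}v\,dx\le K$ for some constant $K$, and let $\Lambda^\delta$ be its image under $v\mapsto v+\delta$. Let $\gamma\in(0,\frac12)$. **Solutions.** A solution consists of a probability space $(\Omega,\mathcal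 F,P)$ with a complete right-continuous filtration $(\mathcal F_t)_{t\in[0,T]}$, independent standard $\mathcal F_t$-Brownian motions $\beta_k$, $k\in\mathbb Z$ (the coordinates of the $Q$-Wiener process $\sum_k\lambda_kg_k\beta_k$), a random variable $u_0^\delta\in L^2(\Omega;H^1_{\mathrm{per}}(\mathcal O))$ with law $\Lambda^\delta$, and a continuous $L^2(\mathcal O)$-valued $\mathcal F_t$-adapted process $u\in L^2(\Omega;L^2(0,T;H^1_{\mathrm{per}}(\mathcal O)))\cap L^2(\Omega;C^{\gamma,\gamma/4}([0,L]\times[0,T]))$ (Hölder exponent $\gamma$ in space, $\gamma/4$ in time) such that $u_{xxx}\in L^2_{\mathrm{loc}}(\{u>0\})$ for almost all $(\omega,t)$ and: 1. almost surely, $u(t,\cdot)$ is strictly positive for almost all $t\in[0,T]$; 2. for all $t\in[0,T]$ and $\phi\in H^1_{\mathrm{per}}(\mathcal O)$, almost surely $$\int_{\mathcal O}(u(t)-u_0^\delta)\phi\,dx=\int_0^t\!\!\int_{\mathcal O}u^nu_{xxx}\phi_x\,dx\,ds-(C_{\mathrm{Strat}}+S)\int_0^t\!\!\int_{\mathcal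 O}u^{n-2}u_x\phi_x\,dx\,ds-\sum_{k\in\mathbb Z}\int_0^t\!\!\int_{\mathcal O}\lambda_kg_ku^{n/2}\phi_x\,dx\,d\beta_k;$$ 3. for every $q\ge1$ the $q$-th moments of the following quantities are finite: $\sup_{t\in[0,T]}\frac12\int_{\mathcal O}u_x^2(t)\,dx$ and the integrals over $\mathcal O\times(0,T)$ of $u^nu_{xxx}^2$, $u^{n-4}u_x^4$, $u^{n-2}u_{xx}^2$, $u_{xx}^2$ and $u^{-2}u_x^2$. Here $u_x,u_{xx}$ are weak derivatives on the torus $\mathbb R/L\mathbb Z$, and $u_{xxx}$ is the weak third derivative on the open set $\{u(\omega,t,\cdot)>0\}$ of the torus. **Proposition.** For every $n\in(2,3)$ there is a constant $C$, depending only on $n$, such that for all data and every solution $u$ as above the following holds: almost surely, for almost every $t\in[0,T]$, the weak derivatives $\bigl(u^{\frac{n+2}{6}}\bigr)_x$, $\bigl(u^{\frac{n+2}{3}}\bigr)_{xx}$, $\bigl(u^{\frac{n+2}{2}}\bigr)_{xxx}$ of powers of $u=u(\omega,t,\cdot)$ exist on the torus, and for every $L$-periodic Lipschitz function $\zeta$,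 i.e. $\zeta\in W^{1,\infty}_{\mathrm{per}}(\mathcal O)$, $$\int_{\mathcal O}\zeta^6\bigl|\bigl(u^{\frac{n+2}{6}}\bigr)_x\bigr|^6dx\le C\int_{\{u>0\}}\zeta^6u^n|u_{xxx}|^2dx+C\int_{\mathcal O}|\zeta_x|^6u^{n+2}dx,$$ $$\int_{\mathcal O}\zeta^6\bigl|\bigl(u^{\frac{n+2}{3}}\bigr)_{xx}\bigr|^3dx\le C\int_{\{u>0\}}\zeta^6u^n|u_{xxx}|^2dx+C\int_{\mathcal O}|\zeta_x|^6u^{n+2}dx,$$ $$\int_{\mathcal O}\zeta^6\bigl|\bigl(u^{\frac{n+2}{2}}\bigr)_{xxx}\bigr|^2dx\le C\int_{\{u>0\}}\zeta^6u^n|u_{xxx}|^2dx+C\int_{\mathcal O}|\zeta_x|^6u^{n+2}dx.$$ -/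

import Mathlib

open MeasureTheory ProbabilityTheory Filter Topology
open scoped NNReal ENNReal

namespace ThinFilm

/-! ### Weak derivatives and periodic Sobolev functions

Functions on the periodic domain `(0, L)` are represented by `L`-periodic functions on `ℝ`;
a weak derivative on the whole line of such a function is exactly a weak derivative on the torus
`ℝ / Lℤ`. -/

/-- `g` is the weak (distributional) derivative of order `k` of `f` on the open set `U ⊆ ℝ`. -/
structure HasWeakDeriv (k : ℕ) (U : Set ℝ) (f g : ℝ → ℝ) : Prop where
  locInt_fun : LocallyIntegrableOn f U volume
  locInt_deriv : LocallyIntegrableOn g U volume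
  integral_eq : ∀ φ : ℝ → ℝ, ContDiff ℝ (⊤ : ℕ∞) φ → HasCompactSupport φ → tsupport φ ⊆ U →
    ∫ x, f x * iteratedDeriv k φ x = (-1) ^ k * ∫ x, g x * φ x

/-- Lebesgue measure on the spatial domain `(0, L)`. -/
noncomputable abbrev domainMeasure (L : ℝ) : Measure ℝ := volume.restrict (Set.Ioo 0 L)

/-- The real Hilbert space `L²(0, L)`. -/
noncomputable abbrev L2 (L : ℝ) : Type := Lp ℝ 2 (domainMeasure L)

lemma integrable_mul_of_continuous {L : ℝ} (v : L2 L) {ψ : ℝ → ℝ} (hψ : Continuous ψ) :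
    Integrable (fun x => v x * ψ x) (domainMeasure L) := by
  obtain ⟨K, hK⟩ := (isCompact_Icc (a := (0 : ℝ)) (b := L)).exists_bound_of_continuousOn
    hψ.continuousOn
  refine Integrable.mul_bdd (c := K)
    ((Lp.memLp v).integrable (by norm_num)) hψ.aestronglyMeasurable ?_
  filter_upwards [ae_restrict_mem measurableSet_Ioo] with x hx
  exact hK x (Set.Ioo_subset_Icc_self hx)

/-- The periodic Sobolev space `H¹_per(0, L)`: pairs `(v, v_x)` in `L² × L²` such that `v_x` is the
weak derivative of `v` with respect to smooth periodic test functions. The norm inherited from the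
product is equivalent to the usual Sobolev norm. -/
noncomputable def H1per (L : ℝ) : Submodule ℝ (L2 L × L2 L) where
  carrier := {p | ∀ φ : ℝ → ℝ, ContDiff ℝ (⊤ : ℕ∞) φ → Function.Periodic φ L →
    ∫ x, p.1 x * deriv φ x ∂domainMeasure L = -∫ x, p.2 x * φ x ∂domainMeasure L}
  zero_mem' := by
    intro φ _ _
    have h1 : (fun x => ((0 : L2 L × L2 L).1 : ℝ → ℝ) x * deriv φ x) =ᵐ[domainMeasure L] 0 := by
      filter_upwards [Lp.coeFn_zero ℝ 2 (domainMeasure L)] with x hx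
      simp only [Prod.fst_zero, hx, Pi.zero_apply, zero_mul]
    have h2 : (fun x => ((0 : L2 L × L2 L).2 : ℝ → ℝ) x * φ x) =ᵐ[domainMeasure L] 0 := by
      filter_upwards [Lp.coeFn_zero ℝ 2 (domainMeasure L)] with x hx
      simp only [Prod.snd_zero, hx, Pi.zero_apply, zero_mul]
    rw [integral_congr_ae h1, integral_congr_ae h2]
    simp
  add_mem' := by
    intro p q hp hq φ hφ hper
    have hc : Continuous φ := hφ.continuous
    have hd : Continuous (deriv φ) := hφ.continuous_deriv (by simp)
    have h1 : (fun x => ((p + q).1 : ℝ → ℝ) x * deriv φ x) =ᵐ[domainMeasure L]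
        fun x => p.1 x * deriv φ x + q.1 x * deriv φ x := by
      filter_upwards [Lp.coeFn_add p.1 q.1] with x hx
      simp only [Prod.fst_add, hx, Pi.add_apply, add_mul]
    have h2 : (fun x => ((p + q).2 : ℝ → ℝ) x * φ x) =ᵐ[domainMeasure L]
        fun x => p.2 x * φ x + q.2 x * φ x := by
      filter_upwards [Lp.coeFn_add p.2 q.2] with x hx
      simp only [Prod.snd_add, hx, Pi.add_apply, add_mul]
    rw [integral_congr_ae h1, integral_congr_ae h2,
      integral_add (integrable_mul_of_continuous p.1 hd) (integrable_mul_of_continuous q.1 hd),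
      integral_add (integrable_mul_of_continuous p.2 hc) (integrable_mul_of_continuous q.2 hc),
      hp φ hφ hper, hq φ hφ hper]
    ring
  smul_mem' := by
    intro c p hp φ hφ hper
    have h1 : (fun x => ((c • p).1 : ℝ → ℝ) x * deriv φ x) =ᵐ[domainMeasure L]
        fun x => c * (p.1 x * deriv φ x) := by
      filter_upwards [Lp.coeFn_smul c p.1] with x hx
      simp only [Prod.smul_fst, hx, Pi.smul_apply, smul_eq_mul, mul_assoc]
    have h2 : (fun x => ((c • p).2 : ℝ → ℝ) x * φ x) =ᵐ[domainMeasure L]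
        fun x => c * (p.2 x * φ x) := by
      filter_upwards [Lp.coeFn_smul c p.2] with x hx
      simp only [Prod.smul_snd, hx, Pi.smul_apply, smul_eq_mul, mul_assoc]
    rw [integral_congr_ae h1, integral_congr_ae h2, integral_const_mul, integral_const_mul,
      hp φ hφ hper]
    ring

noncomputable instance (L : ℝ) : MeasurableSpace (H1per L) := borel _

instance (L : ℝ) : BorelSpace (H1per L) := ⟨rfl⟩

/-- The function underlying an element of `H¹_per`. -/
noncomputable abbrev fnOf {L : ℝ} (v : H1per L) : ℝ → ℝ := v.1.1

/-- The weak derivative of an element of `H¹_per`. -/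
noncomputable abbrev dxOf {L : ℝ} (v : H1per L) : ℝ → ℝ := v.1.2

lemma const_mem_H1per (L δ : ℝ) :
    ((Lp.const 2 (domainMeasure L) δ, 0) : L2 L × L2 L) ∈ H1per L := by
  intro φ hφ hper
  have hd : Continuous (deriv φ) := hφ.continuous_deriv (by simp)
  have h1 : (fun x => (Lp.const 2 (domainMeasure L) δ : ℝ → ℝ) x * deriv φ x)
      =ᵐ[domainMeasure L] fun x => δ * deriv φ x := by
    filter_upwards [Lp.coeFn_const 2 (domainMeasure L) δ] with x hx
    rw [hx, Function.const_apply]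
  have h2 : (fun x => ((0 : L2 L) : ℝ → ℝ) x * φ x) =ᵐ[domainMeasure L] 0 := by
    filter_upwards [Lp.coeFn_zero ℝ 2 (domainMeasure L)] with x hx
    simp only [hx, Pi.zero_apply, zero_mul]
  rw [integral_congr_ae h1, integral_congr_ae h2, integral_const_mul]
  rcases le_or_gt L 0 with hL | hL
  · simp [domainMeasure, Set.Ioo_eq_empty (not_lt.mpr hL)]
  · have h3 : ∫ x, deriv φ x ∂domainMeasure L = φ L - φ 0 := by
      rw [domainMeasure, ← integral_Ioc_eq_integral_Ioo,
        ← intervalIntegral.integral_of_le hL.le]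
      exact intervalIntegral.integral_deriv_eq_sub
        (fun x _ => (hφ.differentiable (by simp)) x) (hd.intervalIntegrable _ _)
    have h4 : φ L = φ 0 := by simpa using hper 0
    rw [h3, h4]
    simp

/-- The shift `v ↦ v + δ` on `H¹_per`. -/
noncomputable def H1per.shift {L : ℝ} (δ : ℝ) (v : H1per L) : H1per L :=
  v + ⟨(Lp.const 2 (domainMeasure L) δ, 0), const_mem_H1per L δ⟩

/-! ### Noise, parameters, initial data -/

/-- The orthonormal basis of `L²(0, L)` of eigenfunctions of the periodic Laplacian. -/
noncomputable def basisFun (L : ℝ) (k : ℤ) (x : ℝ) : ℝ :=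
  if 0 < k then √(2 / L) * Real.sin (2 * Real.pi * k * x / L)
  else if k = 0 then 1 / √L
  else √(2 / L) * Real.cos (2 * Real.pi * k * x / L)

/-- The assumptions on the coefficients of the coloured noise. -/
structure IsNoiseSpectrum (lam : ℤ → ℝ) : Prop where
  nonneg : ∀ k, 0 ≤ lam k
  symm : ∀ k, lam (-k) = lam k
  summable : Summable fun k : ℤ => (k : ℝ) ^ 4 * lam k ^ 2

/-- The constant `C_Strat` in front of the Stratonovich correction term. -/
noncomputable def cStrat (n L : ℝ) (lam : ℤ → ℝ) : ℝ :=
  1 / 2 * (n ^ 2 / 4) * (lam 0 ^ 2 / L + ∑' k : ℕ, 2 * lam ((k : ℤ) + 1) ^ 2 / L)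

/-- The law of the nonnegative initial data (before the shift by `δ`): a probability measure on
`H¹_per` concentrated on nonnegative functions of uniformly bounded energy and mass. -/
structure IsInitialLaw {L : ℝ} (Λ : Measure (H1per L)) : Prop where
  prob : IsProbabilityMeasure Λ
  nonneg : ∀ᵐ v ∂Λ, ∀ᵐ x ∂domainMeasure L, 0 ≤ fnOf v x
  bounded : ∃ K : ℝ, ∀ᵐ v ∂Λ,
    (∫ x, 1 / 2 * dxOf v x ^ 2 ∂domainMeasure L) + ∫ x, fnOf v x ∂domainMeasure L ≤ K

/-! ### Wiener processes and the Itô integral on `[0, T]` -/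

/-- The time interval `[0, T]`. -/
abbrev Time (T : ℝ) : Type := Set.Icc (0 : ℝ) T

/-- Lebesgue measure on `[0, T]`. -/
noncomputable instance (T : ℝ) : MeasureSpace (Time T) := Measure.Subtype.measureSpace

variable {Ω : Type*} {mΩ : MeasurableSpace Ω} {T : ℝ}

/-- `β` is a family of independent standard real Brownian motions on `[0, T]` with respect to the
filtration `𝓕`, i.e. the coordinates of the `Q`-Wiener process `∑ₖ λₖ gₖ βₖ`. -/
structure IsBrownianFamily (P : Measure Ω) (𝓕 : Filtration (Time T) mΩ)
    (β : ℤ → Time T → Ω → ℝ) : Prop where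
  adapted : ∀ k, StronglyAdapted 𝓕 (β k)
  continuous : ∀ k, ∀ᵐ ω ∂P, Continuous fun t => β k t ω
  zero : ∀ k (t : Time T), (t : ℝ) = 0 → ∀ᵐ ω ∂P, β k t ω = 0
  gaussian : ∀ k (s t : Time T), s ≤ t →
    P.map (fun ω => β k t ω - β k s ω) = gaussianReal 0 (Real.toNNReal (t - s))
  indep_past : ∀ s t : Time T, s ≤ t →
    Indep (⨆ k : ℤ, MeasurableSpace.comap (fun ω => β k t ω - β k s ω) inferInstance) (𝓕 s) P
  indep : iIndepFun (fun (k : ℤ) (ω : Ω) (t : Time T) => β k t ω) P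

/-- Simple adapted processes: finite sums of `ξᵢ 1_{(tᵢ, tᵢ₊₁]}` with `ξᵢ` bounded and
`𝓕_{tᵢ}`-measurable. -/
structure SimpleProcess (𝓕 : Filtration (Time T) mΩ) where
  size : ℕ
  time : ℕ → Time T
  coeff : ℕ → Ω → ℝ
  time_mono : Monotone time
  coeff_meas : ∀ i, StronglyMeasurable[𝓕 (time i)] (coeff i)
  coeff_bdd : ∃ K : ℝ, ∀ i ω, |coeff i ω| ≤ K

/-- The process defined by the data of a simple process. -/
noncomputable def SimpleProcess.eval {𝓕 : Filtration (Time T) mΩ} (H : SimpleProcess 𝓕)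
    (s : Time T) (ω : Ω) : ℝ :=
  ∑ i ∈ Finset.range H.size,
    (Set.Ioc (H.time i) (H.time (i + 1))).indicator (fun _ => H.coeff i ω) s

/-- The elementary stochastic integral `∫₀ᵗ H dB` of a simple process. -/
noncomputable def SimpleProcess.integral {𝓕 : Filtration (Time T) mΩ} (H : SimpleProcess 𝓕)
    (B : Time T → Ω → ℝ) (t : Time T) (ω : Ω) : ℝ :=
  ∑ i ∈ Finset.range H.size,
    H.coeff i ω * (B (min t (H.time (i + 1))) ω - B (min t (H.time i)) ω)

/-- `I` is the Itô integral `∫₀ᵗ X dB` of the (square integrable) process `X` against the Brownian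
motion `B`: the `L²(Ω)`-limit of the integrals of simple processes that converge to `X` in
`L²(Ω × [0, t])`. -/
def IsItoIntegral (P : Measure Ω) (𝓕 : Filtration (Time T) mΩ) (B X : Time T → Ω → ℝ)
    (t : Time T) (I : Ω → ℝ) : Prop :=
  MemLp I 2 P ∧ ∃ H : ℕ → SimpleProcess 𝓕,
    Tendsto (fun m => ∫⁻ ω, (∫⁻ s in Set.Iic t,
      ENNReal.ofReal (((H m).eval s ω - X s ω) ^ 2)) ∂P) atTop (𝓝 0) ∧
    Tendsto (fun m => eLpNorm (fun ω => (H m).integral B t ω - I ω) 2 P) atTop (𝓝 0)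

/-- The stochastic integral `∑ₖ ∫₀ᵗ Xₖ dβₖ`, with unconditional convergence in `L²(Ω)`. -/
def IsItoSeries (P : Measure Ω) (𝓕 : Filtration (Time T) mΩ) (β X : ℤ → Time T → Ω → ℝ)
    (t : Time T) (M : Ω → ℝ) : Prop :=
  ∃ I : ℤ → Ω → ℝ, (∀ k, IsItoIntegral P 𝓕 (β k) (X k) t (I k)) ∧
    Tendsto (fun F : Finset ℤ => eLpNorm (fun ω => (∑ k ∈ F, I k ω) - M ω) 2 P) atTop (𝓝 0)

/-! ### Solutions of the stochastic thin-film equation -/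

/-- The space-time integral `∫₀ᵀ ∫_{(0,L)} f dx ds` of a nonnegative function. -/
noncomputable def spaceTime (L : ℝ) (f : Time T → ℝ → ℝ) : ℝ≥0∞ :=
  ∫⁻ s, ∫⁻ x, ENNReal.ofReal (f s x) ∂domainMeasure L

/-- A martingale solution of
`du = -(uⁿ u_xxx)_x dt + (C_Strat + S) (u^{n-2} u_x)_x dt + ∑ₖ λₖ (gₖ u^{n/2})_x dβₖ`
on `(0, L) × [0, T]` with periodic boundary conditions, whose initial datum is distributed as
`v + δ` with `v` distributed according to `Λ`. The stochastic basis is `(Ω, mΩ, 𝓕, P)`. The fields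
`ux`, `uxx` and `uxxx` are measurable representatives of the weak spatial derivatives of `u`, the
last one being a derivative on the positivity set of `u` only. -/
structure MartingaleSolution (P : Measure Ω) (n L T δ γ S : ℝ) (lam : ℤ → ℝ)
    (Λ : Measure (H1per L)) where
  𝓕 : Filtration (Time T) mΩ
  /-- completeness of the filtration -/
  complete : ∀ (t : Time T) (A : Set Ω), P A = 0 → MeasurableSet[𝓕 t] A
  rightContinuous : 𝓕.IsRightContinuous
  β : ℤ → Time T → Ω → ℝ
  brownian : IsBrownianFamily P 𝓕 β
  u₀ : Ω → H1per L
  u₀_memLp : MemLp u₀ 2 P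
  u : Time T → Ω → ℝ → ℝ
  ux : Time T → Ω → ℝ → ℝ
  uxx : Time T → Ω → ℝ → ℝ
  uxxx : Time T → Ω → ℝ → ℝ
  u_meas : Measurable fun p : Time T × Ω × ℝ => u p.1 p.2.1 p.2.2
  ux_meas : Measurable fun p : Time T × Ω × ℝ => ux p.1 p.2.1 p.2.2
  uxx_meas : Measurable fun p : Time T × Ω × ℝ => uxx p.1 p.2.1 p.2.2
  uxxx_meas : Measurable fun p : Time T × Ω × ℝ => uxxx p.1 p.2.1 p.2.2
  periodic : ∀ t ω, Function.Periodic (u t ω) L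
  adapted : ∀ x, StronglyAdapted 𝓕 fun t ω => u t ω x
  /-- `u ∈ L²(Ω; C^{γ, γ/4}([0, L] × [0, T]))` (exponent `γ` in space and `γ/4` in time); in
  particular almost every path is a continuous `L²(0, L)`-valued function of time -/
  hoelder : ∃ K : Ω → ℝ, MemLp K 2 P ∧ ∀ᵐ ω ∂P, ∀ s t : Time T,
    ∀ x ∈ Set.Icc 0 L, ∀ y ∈ Set.Icc 0 L, |u t ω x| ≤ K ω ∧
      |u t ω x - u s ω y| ≤ K ω * (|x - y| ^ γ + |(t : ℝ) - s| ^ (γ / 4))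
  ux_weak : ∀ᵐ ω ∂P, ∀ t, HasWeakDeriv 1 Set.univ (u t ω) (ux t ω)
  uxx_weak : ∀ᵐ ω ∂P, ∀ᵐ t, HasWeakDeriv 2 Set.univ (u t ω) (uxx t ω)
  uxxx_weak : ∀ᵐ ω ∂P, ∀ᵐ t, HasWeakDeriv 3 {x | 0 < u t ω x} (u t ω) (uxxx t ω)
  /-- `u_xxx ∈ L²_loc({u > 0})` -/
  uxxx_loc : ∀ᵐ ω ∂P, ∀ᵐ t, ∀ K : Set ℝ, IsCompact K → K ⊆ {x | 0 < u t ω x} →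
    ∫⁻ x in K, ENNReal.ofReal (uxxx t ω x ^ 2) < ⊤
  /-- `u ∈ L²(Ω; L²(0, T; H¹_per))` -/
  u_L2H1 : ∫⁻ ω, spaceTime L (fun s x => u s ω x ^ 2 + ux s ω x ^ 2) ∂P < ⊤
  positive : ∀ᵐ ω ∂P, ∀ᵐ t, ∀ x, 0 < u t ω x
  initial_law : P.map u₀ = Λ.map (H1per.shift δ)
  weak_form : ∀ (t : Time T) (φ : H1per L), ∃ M : Ω → ℝ,
    IsItoSeries P 𝓕 β
      (fun k s ω => ∫ x, lam k * basisFun L k x * u s ω x ^ (n / 2) * dxOf φ x ∂domainMeasure L)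
      t M ∧
    ∀ᵐ ω ∂P, ∫ x, (u t ω x - fnOf (u₀ ω) x) * fnOf φ x ∂domainMeasure L =
      (∫ s in Set.Iic t, ∫ x, u s ω x ^ n * uxxx s ω x * dxOf φ x ∂domainMeasure L)
      - (cStrat n L lam + S) *
        (∫ s in Set.Iic t, ∫ x, u s ω x ^ (n - 2) * ux s ω x * dxOf φ x ∂domainMeasure L)
      - M ω
  /-- the energy-entropy estimate: all moments are finite -/
  estimate : ∀ q : ℝ, 1 ≤ q →
    (∫⁻ ω, (⨆ t : Time T, ∫⁻ x, ENNReal.ofReal (1 / 2 * ux t ω x ^ 2) ∂domainMeasure L) ^ q ∂P)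
    + (∫⁻ ω, spaceTime L (fun s x => u s ω x ^ n * uxxx s ω x ^ 2) ^ q ∂P)
    + (∫⁻ ω, spaceTime L (fun s x => u s ω x ^ (n - 4) * ux s ω x ^ 4) ^ q ∂P)
    + (∫⁻ ω, spaceTime L (fun s x => u s ω x ^ (n - 2) * uxx s ω x ^ 2) ^ q ∂P)
    + (∫⁻ ω, spaceTime L (fun s x => uxx s ω x ^ 2) ^ q ∂P)
    + (∫⁻ ω, spaceTime L (fun s x => u s ω x ^ (-2 : ℝ) * ux s ω x ^ 2) ^ q ∂P) < ⊤

/-- The right-hand side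
`C ∫_{u > 0} ζ⁶ uⁿ |u_xxx|² dx + C ∫ |ζ_x|⁶ u^{n+2} dx` (integrals over `(0, L)`). For a Lipschitz
function `ζ` the derivative `ζ_x` exists almost everywhere. -/
noncomputable def bernisBound (C : ℝ≥0) (n L : ℝ) (ζ u uxxx : ℝ → ℝ) : ℝ≥0∞ :=
  C * (∫⁻ x in Set.Ioo 0 L ∩ {x | 0 < u x}, ENNReal.ofReal (ζ x ^ 6 * u x ^ n * |uxxx x| ^ 2))
  + C * (∫⁻ x in Set.Ioo 0 L, ENNReal.ofReal (|deriv ζ x| ^ 6 * u x ^ (n + 2)))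

end ThinFilm

namespace ThinFilm

/-! The stochastic structure enters only through path regularity. For almost every path and time the
profile is continuous, periodic and positive, so its weak third derivative `w` lives on the whole
line; hence it is C² with locally absolutely continuous second derivative
(`HasWeakDeriv.regularity`). What remains is a deterministic inequality of Bernis type,
`bernis_of_hasWeakDeriv`.

Put r = u'/u, q = u''/u, p = w/u. Then uⁿ w² = u^(n+2) p², and the derivatives of u^m are u^m times
polynomials in r, q, p. So all three estimates follow from a bound on ∫ ζ⁶ u^(n+2) (r⁶ + |q|³),
which is `bernis_core`.

For that bound, the derivative of ζ⁶ u^(n+2) (-(n-2)/5 r⁵ + r³q + r q|q|/4) is integrated over a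
period, with result zero (`integral_bernisForm_eq_zero`). The coefficient of r⁵ is the one that
cancels r⁴q; it leaves (n-2)(3-n)/5 r⁶, which is positive precisely for 2 < n < 3. Since r' = q -
r², the last summand produces |q|³/4. Everything else is absorbed by Young's inequality into these
good terms, 3r²q², and the two integrals on the right (`exists_le_bernisForm`). This pointwise step
involves no parameter except n, whence the dependence of the constant. -/

/-! ### Locally absolutely continuous functions -/

/-- `f` is absolutely continuous on every compact interval, with almost everywhere derivative `g`. -/
structure LocallyAC (f g : ℝ → ℝ) : Prop where
  ac : ∀ a b, AbsolutelyContinuousOnInterval f a b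
  hasDerivAt : ∀ᵐ x, HasDerivAt f (g x) x

namespace LocallyAC

variable {f g f₁ g₁ f₂ g₂ : ℝ → ℝ}

lemma of_hasDerivAt (hf : ∀ x, HasDerivAt f (g x) x) (hg : Continuous g) : LocallyAC f g := by
  have hd : deriv f = g := funext fun x => (hf x).deriv
  have hc : ContDiff ℝ 1 f := by
    rw [contDiff_one_iff_deriv]
    exact ⟨fun x => (hf x).differentiableAt, hd ▸ hg⟩
  exact ⟨fun a b => hc.contDiffOn.absolutelyContinuousOnInterval, .of_forall hf⟩

/-- Rademacher's theorem in one dimension; it admits the merely Lipschitz weight ζ into the product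
rule. -/
lemma of_lipschitzWith {K : ℝ≥0} (hf : LipschitzWith K f) : LocallyAC f (deriv f) := by
  refine ⟨fun a b => (hf.lipschitzOnWith (s := Set.uIcc a b)).absolutelyContinuousOnInterval, ?_⟩
  filter_upwards [hf.ae_differentiableAt_of_real] with x hx using hx.hasDerivAt

lemma of_locallyIntegrable (hg : LocallyIntegrable g volume) (c : ℝ) :
    LocallyAC (fun x => ∫ t in c..x, g t) g := by
  refine ⟨fun a b => ?_, ?_⟩
  -- Absolute continuity of a primitive is available on intervals containing the base point, so the
  -- interval is enlarged to include `c`.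
  · set A := min c (min a b)
    set B := max c (max a b)
    have hAB : A ≤ B := (min_le_left _ _).trans (le_max_left _ _)
    have hi : IntervalIntegrable g volume A B :=
      (hg.integrableOn_isCompact isCompact_uIcc).intervalIntegrable
    refine (hi.absolutelyContinuousOnInterval_intervalIntegral (c := c) ?_).mono ?_
    · rw [Set.uIcc_of_le hAB]
      exact ⟨min_le_left _ _, le_max_left _ _⟩
    · rw [Set.uIcc_of_le hAB, Set.uIcc]
      exact Set.Icc_subset_Icc (min_le_right _ _) (le_max_right _ _)
  · filter_upwards [LocallyIntegrable.ae_hasDerivAt_integral hg] with x hx using hx c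

lemma congr (h : LocallyAC f g) (hfg : ∀ x, g x = g₁ x) : LocallyAC f g₁ :=
  (funext hfg : g = g₁) ▸ h

lemma continuous (h : LocallyAC f g) : Continuous f := by
  refine continuous_iff_continuousAt.2 fun x => ?_
  refine (h.ac (x - 1) (x + 1)).continuousOn.continuousAt ?_
  rw [Set.uIcc_of_le (by linarith)]
  exact Icc_mem_nhds (by linarith) (by linarith)

lemma add (h₁ : LocallyAC f₁ g₁) (h₂ : LocallyAC f₂ g₂) :
    LocallyAC (fun x => f₁ x + f₂ x) (fun x => g₁ x + g₂ x) := by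
  refine ⟨fun a b => (h₁.ac a b).add (h₂.ac a b), ?_⟩
  filter_upwards [h₁.hasDerivAt, h₂.hasDerivAt] with x hx₁ hx₂ using hx₁.add hx₂

lemma mul (h₁ : LocallyAC f₁ g₁) (h₂ : LocallyAC f₂ g₂) :
    LocallyAC (fun x => f₁ x * f₂ x) (fun x => g₁ x * f₂ x + f₁ x * g₂ x) := by
  refine ⟨fun a b => (h₁.ac a b).mul (h₂.ac a b), ?_⟩
  filter_upwards [h₁.hasDerivAt, h₂.hasDerivAt] with x hx₁ hx₂ using hx₁.mul hx₂

lemma const_mul (c : ℝ) (h : LocallyAC f g) :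
    LocallyAC (fun x => c * f x) (fun x => c * g x) := by
  refine ⟨fun a b => (h.ac a b).const_mul c, ?_⟩
  filter_upwards [h.hasDerivAt] with x hx using hx.const_mul c

lemma pow (h : LocallyAC f g) (k : ℕ) :
    LocallyAC (fun x => f x ^ k) (fun x => k * f x ^ (k - 1) * g x) := by
  refine ⟨fun a b => ?_, ?_⟩
  · induction k with
    | zero =>
      simpa using (of_hasDerivAt (f := fun _ => (1 : ℝ)) (fun x => hasDerivAt_const x _)
        continuous_const).ac a b
    | succ k ih => simpa only [pow_succ] using ih.fun_mul (h.ac a b)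
  · filter_upwards [h.hasDerivAt] with x hx using hx.pow k

lemma abs_ac {a b : ℝ} (h : AbsolutelyContinuousOnInterval f a b) :
    AbsolutelyContinuousOnInterval (fun x => |f x|) a b := by
  refine squeeze_zero (fun t => Finset.sum_nonneg fun i _ => dist_nonneg) (fun t => ?_) h
  gcongr with i
  simp only [Real.dist_eq]
  exact abs_abs_sub_abs_le_abs_sub _ _

/-- The map x|x| is differentiable even at the origin. It replaces x² in the integrated quantity
because r'q² would contain q³, which has no sign, whereas r'q|q| contains |q|³. -/
lemma hasDerivAt_mul_abs (x : ℝ) : HasDerivAt (fun x : ℝ => x * |x|) (2 * |x|) x := by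
  rcases lt_trichotomy x 0 with hx | rfl | hx
  · have := (hasDerivAt_id x).mul (hasDerivAt_abs_neg hx)
    refine this.congr_deriv ?_
    simp [abs_of_neg hx]; ring
  · rw [hasDerivAt_iff_isLittleO_nhds_zero]
    simp only [zero_add, abs_zero, mul_zero, sub_zero, smul_eq_mul]
    have h1 : (fun h : ℝ => |h|) =o[𝓝 0] (fun _ => (1 : ℝ)) := by
      rw [Asymptotics.isLittleO_one_iff]
      exact (continuous_abs.tendsto' 0 0 (by simp))
    simpa using (Asymptotics.isBigO_refl (fun h : ℝ => h) (𝓝 0)).mul_isLittleO h1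
  · have := (hasDerivAt_id x).mul (hasDerivAt_abs_pos hx)
    refine this.congr_deriv ?_
    simp [abs_of_pos hx]; ring

lemma mul_abs (h : LocallyAC f g) :
    LocallyAC (fun x => f x * |f x|) (fun x => 2 * |f x| * g x) := by
  -- The derivative comes from the chain rule, since the product rule would require differentiating
  -- |f| at zeros of f.
  refine ⟨fun a b => (h.ac a b).mul (abs_ac (h.ac a b)), ?_⟩
  filter_upwards [h.hasDerivAt] with x hx
  exact (hasDerivAt_mul_abs (f x)).comp x hx

lemma deriv_ae_eq (h : LocallyAC f g) : deriv f =ᵐ[volume] g := by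
  filter_upwards [h.hasDerivAt] with x hx using hx.deriv

lemma intervalIntegrable (h : LocallyAC f g) (a b : ℝ) : IntervalIntegrable g volume a b :=
  (h.ac a b).intervalIntegrable_deriv.congr_ae (ae_restrict_of_ae h.deriv_ae_eq)

lemma integral_eq_sub (h : LocallyAC f g) (a b : ℝ) : ∫ x in a..b, g x = f b - f a := by
  rw [← (h.ac a b).integral_deriv_eq_sub]
  refine intervalIntegral.integral_congr_ae ?_
  filter_upwards [h.deriv_ae_eq] with x hx _ using hx.symm

lemma locallyIntegrable (h : LocallyAC f g) : LocallyIntegrable g volume := by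
  intro x
  refine ⟨Set.Icc (x - 1) (x + 1), Icc_mem_nhds (by linarith) (by linarith), ?_⟩
  rw [← intervalIntegrable_iff_integrableOn_Icc_of_le (by linarith)]
  exact h.intervalIntegrable _ _

/-- Integration by parts against a compactly supported smooth function. -/
lemma integral_mul_deriv (h : LocallyAC f g) {φ : ℝ → ℝ} (hφ : ContDiff ℝ (⊤ : ℕ∞) φ)
    (hs : HasCompactSupport φ) : ∫ x, f x * deriv φ x = -∫ x, g x * φ x := by
  obtain ⟨R, hR0, hR⟩ := hs.isCompact.isBounded.subset_ball_lt 0 0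
  have hRs : tsupport φ ⊆ Set.Ioo (-R) R := by
    simpa [Real.ball_eq_Ioo] using hR
  have hIoc : tsupport φ ⊆ Set.Ioc (-R) R := hRs.trans Set.Ioo_subset_Ioc_self
  have hd : Continuous (deriv φ) := hφ.continuous_deriv (by simp)
  have hφ' : LocallyAC φ (deriv φ) :=
    of_hasDerivAt (fun x => (hφ.differentiable (by simp) x).hasDerivAt) hd
  -- The boundary terms vanish because the support of φ lies strictly inside (-R, R).
  have hprod := (h.mul hφ').integral_eq_sub (-R) R
  have hz : ∀ x, x ∉ Set.Ioo (-R) R → φ x = 0 := fun x hx =>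
    image_eq_zero_of_notMem_tsupport fun hx' => hx (hRs hx')
  rw [hz R (by simp), hz (-R) (by simp)] at hprod
  have hi1 : IntervalIntegrable (fun x => g x * φ x) volume (-R) R :=
    (h.intervalIntegrable _ _).mul_continuousOn hφ.continuous.continuousOn
  have hi2 : IntervalIntegrable (fun x => f x * deriv φ x) volume (-R) R :=
    (h.continuous.mul hd).intervalIntegrable _ _
  rw [intervalIntegral.integral_add hi1 hi2] at hprod
  have e1 : ∫ x in (-R)..R, g x * φ x = ∫ x, g x * φ x := by
    refine intervalIntegral.integral_eq_integral_of_support_subset fun x hx => hIoc ?_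
    exact subset_tsupport _ fun h0 => hx (by simp [h0])
  have e2 : ∫ x in (-R)..R, f x * deriv φ x = ∫ x, f x * deriv φ x := by
    refine intervalIntegral.integral_eq_integral_of_support_subset fun x hx => hIoc ?_
    refine support_deriv_subset fun h0 => hx (by simp [h0])
  rw [e1, e2] at hprod
  linarith

end LocallyAC

/-! ### Weak derivatives -/

lemma contDiff_iteratedDeriv {φ : ℝ → ℝ} (hφ : ContDiff ℝ (⊤ : ℕ∞) φ) (k : ℕ) :
    ContDiff ℝ (⊤ : ℕ∞) (iteratedDeriv k φ) := by
  induction k with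
  | zero => simpa [iteratedDeriv_zero] using hφ
  | succ k ih =>
    rw [iteratedDeriv_succ]
    exact (contDiff_infty_iff_deriv.1 ih).2

lemma hasCompactSupport_iteratedDeriv {φ : ℝ → ℝ} (hφ : HasCompactSupport φ) (k : ℕ) :
    HasCompactSupport (iteratedDeriv k φ) := by
  induction k with
  | zero => simpa [iteratedDeriv_zero] using hφ
  | succ k ih =>
    rw [iteratedDeriv_succ]
    exact ih.deriv

lemma HasWeakDeriv.of_locallyAC {f g : ℝ → ℝ} (h : LocallyAC f g) :
    HasWeakDeriv 1 Set.univ f g where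
  locInt_fun := h.continuous.locallyIntegrable.locallyIntegrableOn _
  locInt_deriv := h.locallyIntegrable.locallyIntegrableOn _
  integral_eq φ hφ hs _ := by simpa using h.integral_mul_deriv hφ hs

/-- One integration by parts moves the outermost derivative off the test function; iterating builds
weak derivatives of order two and three from absolutely continuous chains. -/
lemma HasWeakDeriv.succ_of_locallyAC {f f₁ g : ℝ → ℝ} {k : ℕ} (h : LocallyAC f f₁)
    (hk : HasWeakDeriv k Set.univ f₁ g) : HasWeakDeriv (k + 1) Set.univ f g where
  locInt_fun := h.continuous.locallyIntegrable.locallyIntegrableOn _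
  locInt_deriv := hk.locInt_deriv
  integral_eq φ hφ hs hU := by
    rw [iteratedDeriv_succ, h.integral_mul_deriv (contDiff_iteratedDeriv hφ k)
      (hasCompactSupport_iteratedDeriv hs k), hk.integral_eq φ hφ hs hU]
    ring

/-- A smooth compactly supported function of integral zero is the derivative of such a function. -/
lemma exists_primitive_of_integral_eq_zero {φ : ℝ → ℝ} (hφ : ContDiff ℝ (⊤ : ℕ∞) φ)
    (hs : HasCompactSupport φ) (h0 : ∫ x, φ x = 0) :
    ∃ Φ : ℝ → ℝ, ContDiff ℝ (⊤ : ℕ∞) Φ ∧ HasCompactSupport Φ ∧ deriv Φ = φ := by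
  obtain ⟨R, hR0, hR⟩ := hs.isCompact.isBounded.subset_ball_lt 0 0
  have hRs : tsupport φ ⊆ Set.Ioo (-R) R := by
    simpa [Real.ball_eq_Ioo] using hR
  have hz : ∀ x, x ∉ Set.Ioo (-R) R → φ x = 0 := fun x hx =>
    image_eq_zero_of_notMem_tsupport fun hx' => hx (hRs hx')
  have hd : ∀ x, HasDerivAt (fun x => ∫ t in (-R)..x, φ t) (φ x) x := fun x =>
    intervalIntegral.integral_hasDerivAt_right (hφ.continuous.intervalIntegrable _ _)
      (hφ.continuous.stronglyMeasurableAtFilter _ _) hφ.continuous.continuousAt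
  have hderiv : deriv (fun x => ∫ t in (-R)..x, φ t) = φ := funext fun x => (hd x).deriv
  refine ⟨fun x => ∫ t in (-R)..x, φ t, ?_, ?_, hderiv⟩
  · rw [contDiff_infty_iff_deriv]
    exact ⟨fun x => (hd x).differentiableAt, by rwa [hderiv]⟩
  · refine HasCompactSupport.of_support_subset_isCompact (isCompact_Icc (a := -R) (b := R)) ?_
    intro x hx
    by_contra hxm
    refine hx ?_
    rw [Set.mem_Icc, not_and_or, not_le, not_le] at hxm
    rcases hxm with hlt | hlt
    · refine (intervalIntegral.integral_zero_ae ?_)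
      refine .of_forall fun t ht => hz t fun ht' => ?_
      rw [Set.uIoc_of_ge hlt.le] at ht
      linarith [ht.2, ht'.1]
    -- To the right of R the primitive has already collected the whole integral of φ, which is zero.
    · rw [← h0]
      refine intervalIntegral.integral_eq_integral_of_support_subset fun t ht => ?_
      have := hRs (subset_tsupport _ ht)
      exact ⟨this.1, (this.2.trans hlt).le⟩

lemma iteratedDeriv_sub_const_mul {φ η : ℝ → ℝ} (hφ : ContDiff ℝ (⊤ : ℕ∞) φ)
    (hη : ContDiff ℝ (⊤ : ℕ∞) η) (c : ℝ) (k : ℕ) (x : ℝ) :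
    iteratedDeriv k (fun x => φ x - c * η x) x = iteratedDeriv k φ x - c * iteratedDeriv k η x := by
  have h1 : ContDiffAt ℝ k φ x := (hφ.of_le (by exact_mod_cast le_top)).contDiffAt
  have h2 : ContDiffAt ℝ k η x := (hη.of_le (by exact_mod_cast le_top)).contDiffAt
  have := iteratedDeriv_fun_sub (n := k) h1
    (contDiffAt_const.mul h2 : ContDiffAt ℝ k (fun x => c * η x) x)
  rw [this, iteratedDeriv_const_mul_field]

lemma integrable_mul_of_hasCompactSupport {h φ : ℝ → ℝ} (hc : Continuous h) (hφ : Continuous φ)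
    (hs : HasCompactSupport φ) : Integrable fun x => h x * φ x :=
  (hc.mul hφ).integrable_of_hasCompactSupport hs.mul_left

/-- If the weak derivative of order `k + 1` vanishes, that of order `k` is constant. -/
lemma exists_const_of_weakDeriv_succ_eq_zero {h : ℝ → ℝ} (hc : Continuous h) (k : ℕ)
    (h0 : ∀ φ : ℝ → ℝ, ContDiff ℝ (⊤ : ℕ∞) φ → HasCompactSupport φ →
      ∫ x, h x * iteratedDeriv (k + 1) φ x = 0) :
    ∃ c : ℝ, ∀ φ : ℝ → ℝ, ContDiff ℝ (⊤ : ℕ∞) φ → HasCompactSupport φ →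
      ∫ x, h x * iteratedDeriv k φ x = c * ∫ x, φ x := by
  have hint : ∀ φ : ℝ → ℝ, ContDiff ℝ (⊤ : ℕ∞) φ → HasCompactSupport φ →
      Integrable fun x => h x * iteratedDeriv k φ x := fun φ hφ hs =>
    integrable_mul_of_hasCompactSupport hc (contDiff_iteratedDeriv hφ k).continuous
      (hasCompactSupport_iteratedDeriv hs k)
  -- The du Bois-Reymond argument: with η of unit mass, φ - (∫φ)η has mean zero, hence is Φ' for a
  -- test function Φ, and the hypothesis applies to Φ. The constant is the pairing with η.
  let η₀ : ContDiffBump (0 : ℝ) := ⟨1, 2, one_pos, one_lt_two⟩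
  set η : ℝ → ℝ := η₀.normed volume
  have hη : ContDiff ℝ (⊤ : ℕ∞) η := η₀.contDiff_normed
  have hηs : HasCompactSupport η := η₀.hasCompactSupport_normed
  have hη1 : ∫ x, η x = 1 := η₀.integral_normed
  refine ⟨∫ x, h x * iteratedDeriv k η x, fun φ hφ hs => ?_⟩
  set c := ∫ x, φ x with hcdef
  have hcη : HasCompactSupport fun x => c * η x := hηs.mul_left
  obtain ⟨Φ, hΦ, hΦs, hΦd⟩ := exists_primitive_of_integral_eq_zero
    (φ := fun x => φ x - c * η x) (hφ.sub (contDiff_const.mul hη)) (by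
      simp only [sub_eq_add_neg]
      exact hs.add hcη.neg) (by
      rw [integral_sub (hφ.continuous.integrable_of_hasCompactSupport hs)
        (Continuous.integrable_of_hasCompactSupport (f := fun x => c * η x)
          (continuous_const.mul hη.continuous) hcη), integral_const_mul, hη1]
      ring)
  have := h0 Φ hΦ hΦs
  rw [iteratedDeriv_succ', hΦd] at this
  simp_rw [iteratedDeriv_sub_const_mul hφ hη] at this
  have e : ∀ x, h x * (iteratedDeriv k φ x - c * iteratedDeriv k η x)
      = h x * iteratedDeriv k φ x - c * (h x * iteratedDeriv k η x) := fun x => by ring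
  simp_rw [e] at this
  rw [integral_sub (hint φ hφ hs) ((hint η hη hηs).const_mul c), integral_const_mul] at this
  linarith

/-- A continuous function with vanishing weak derivative of order `k` is a polynomial of degree
less than `k`. -/
lemma eq_sum_of_weakDeriv_eq_zero (k : ℕ) : ∀ {h : ℝ → ℝ}, Continuous h →
    (∀ φ : ℝ → ℝ, ContDiff ℝ (⊤ : ℕ∞) φ → HasCompactSupport φ →
      ∫ x, h x * iteratedDeriv k φ x = 0) →
    ∃ c : ℕ → ℝ, ∀ x, h x = ∑ i ∈ Finset.range k, c i * x ^ i := by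
  induction k with
  | zero =>
    intro h hc h0
    refine ⟨0, fun x => ?_⟩
    -- Order zero is the fundamental lemma of the calculus of variations; continuity upgrades the
    -- conclusion from almost everywhere to everywhere.
    have hae := ae_eq_zero_of_integral_contDiff_smul_eq_zero hc.locallyIntegrable
      (μ := volume) fun φ hφ hs => by
        simpa [mul_comm] using h0 φ hφ hs
    have := hc.ae_eq_iff_eq volume (g := fun _ => (0 : ℝ)) continuous_const |>.1 hae
    simpa using congrFun this x
  | succ k ih =>
    intro h hc h0
    obtain ⟨c, hck⟩ := exists_const_of_weakDeriv_succ_eq_zero hc k h0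
    -- the monomial whose weak derivative of order `k` is the constant `c`
    have hmono : ∀ φ : ℝ → ℝ, ContDiff ℝ (⊤ : ℕ∞) φ → HasCompactSupport φ → ∀ j : ℕ,
        ∫ x, x ^ j * iteratedDeriv j φ x = (-1) ^ j * j.factorial * ∫ x, φ x := by
      intro φ hφ hs j
      induction j with
      | zero => simp
      | succ j ihj =>
        have hpow : LocallyAC (fun x : ℝ => x ^ (j + 1)) (fun x => (j + 1 : ℝ) * x ^ j) :=
          LocallyAC.of_hasDerivAt (fun x => by simpa using hasDerivAt_pow (j + 1) x)
            (by fun_prop)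
        rw [iteratedDeriv_succ, hpow.integral_mul_deriv (contDiff_iteratedDeriv hφ j)
          (hasCompactSupport_iteratedDeriv hs j)]
        simp_rw [mul_assoc]
        rw [integral_const_mul, ihj, Nat.factorial_succ]
        push_cast
        ring
    set d : ℝ := c / ((-1) ^ k * k.factorial) with hd
    have hdk : d * ((-1) ^ k * k.factorial) = c := by
      rw [hd]
      exact div_mul_cancel₀ _ (mul_ne_zero (pow_ne_zero _ (by norm_num))
        (Nat.cast_ne_zero.2 k.factorial_ne_zero))
    obtain ⟨b, hb⟩ := ih (h := fun x => h x - d * x ^ k) (by fun_prop) fun φ hφ hs => by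
      have hcs := hasCompactSupport_iteratedDeriv hs k
      have hct := (contDiff_iteratedDeriv hφ k).continuous
      simp_rw [sub_mul, mul_assoc]
      rw [integral_sub (integrable_mul_of_hasCompactSupport hc hct hcs)
        ((integrable_mul_of_hasCompactSupport (continuous_pow k) hct hcs).const_mul d),
        integral_const_mul, hmono φ hφ hs k, hck φ hφ hs, ← hdk]
      ring
    refine ⟨Function.update b k d, fun x => ?_⟩
    rw [Finset.sum_range_succ, Function.update_self, Finset.sum_congr rfl (g := fun i => b i * x ^ i)
      fun i hi => by rw [Function.update_of_ne (Finset.mem_range.1 hi).ne], ← hb x]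
    ring

/-- A continuous function with a third weak derivative on the line is twice continuously
differentiable, and its second derivative is locally absolutely continuous. -/
lemma HasWeakDeriv.regularity {u w : ℝ → ℝ} (hu : Continuous u)
    (h : HasWeakDeriv 3 Set.univ u w) :
    ∃ u₁ u₂ : ℝ → ℝ, (∀ x, HasDerivAt u (u₁ x) x) ∧ (∀ x, HasDerivAt u₁ (u₂ x) x) ∧
      LocallyAC u₂ w := by
  have hw : LocallyIntegrable w volume := locallyIntegrableOn_univ.1 h.locInt_deriv
  have hprim : ∀ {f : ℝ → ℝ}, Continuous f → ∀ x,
      HasDerivAt (fun x => ∫ t in (0 : ℝ)..x, f t) (f x) x := fun hf x =>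
    intervalIntegral.integral_hasDerivAt_right (hf.intervalIntegrable _ _)
      (hf.stronglyMeasurableAtFilter _ _) hf.continuousAt
  set W₂ : ℝ → ℝ := fun x => ∫ t in (0 : ℝ)..x, w t
  have h₂ : LocallyAC W₂ w := .of_locallyIntegrable hw 0
  -- The threefold primitive of w has the same third weak derivative as u, so the two differ by a
  -- quadratic polynomial, and u inherits its regularity.
  set W₁ : ℝ → ℝ := fun x => ∫ t in (0 : ℝ)..x, W₂ t
  have d₁ : ∀ x, HasDerivAt W₁ (W₂ x) x := hprim h₂.continuous
  have h₁ : LocallyAC W₁ W₂ := .of_hasDerivAt d₁ h₂.continuous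
  set W₀ : ℝ → ℝ := fun x => ∫ t in (0 : ℝ)..x, W₁ t
  have d₀ : ∀ x, HasDerivAt W₀ (W₁ x) x := hprim h₁.continuous
  have h₀ : LocallyAC W₀ W₁ := .of_hasDerivAt d₀ h₁.continuous
  have hW : HasWeakDeriv 3 Set.univ W₀ w :=
    .succ_of_locallyAC h₀ (.succ_of_locallyAC h₁ (.of_locallyAC h₂))
  obtain ⟨c, hc⟩ := eq_sum_of_weakDeriv_eq_zero 3
      (h := fun x => u x - W₀ x) (hu.sub h₀.continuous) fun φ hφ hs => by
    have hcs := hasCompactSupport_iteratedDeriv hs 3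
    have hct := (contDiff_iteratedDeriv hφ 3).continuous
    simp only [sub_mul]
    rw [integral_sub (integrable_mul_of_hasCompactSupport hu hct hcs)
      (integrable_mul_of_hasCompactSupport h₀.continuous hct hcs),
      h.integral_eq φ hφ hs (Set.subset_univ _), hW.integral_eq φ hφ hs (Set.subset_univ _),
      sub_self]
  have hu' : u = fun x => W₀ x + (c 0 + c 1 * x + c 2 * x ^ 2) := by
    funext x
    have := hc x
    simp only [Finset.sum_range_succ, Finset.sum_range_zero] at this
    simp at this
    linarith
  refine ⟨fun x => W₁ x + (c 1 + 2 * c 2 * x), fun x => W₂ x + 2 * c 2, fun x => ?_, fun x => ?_, ?_⟩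
  · rw [hu']
    refine (d₀ x).add ?_
    refine ((((hasDerivAt_id x).const_mul (c 1)).const_add (c 0)).add
      ((hasDerivAt_pow 2 x).const_mul (c 2))).congr_deriv ?_
    simp; ring
  · refine (d₁ x).add ?_
    refine (((hasDerivAt_id x).const_mul (2 * c 2)).const_add (c 1)).congr_deriv ?_
    simp
  · refine (h₂.add (.of_hasDerivAt (fun x => hasDerivAt_const x (2 * c 2)) continuous_const)).congr
      fun x => add_zero _

/-- The endpoint values agree, so f descends to a continuous function on the circle, of which it is
the pullback. Needed because the Hölder bound covers one period only. -/
lemma continuous_of_periodic {f : ℝ → ℝ} {L : ℝ} (hL : 0 < L) (hp : Function.Periodic f L)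
    (hc : ContinuousOn f (Set.Icc 0 L)) : Continuous f := by
  have : Fact (0 < L) := ⟨hL⟩
  have h1 := AddCircle.liftIco_zero_continuous (p := L) (f := f) (by simpa using (hp 0).symm) hc
  have h2 : f = fun x : ℝ => AddCircle.liftIco L 0 f (x : AddCircle L) := by
    funext x
    have hx : x - toIcoDiv hL 0 x • L ∈ Set.Ico (0 : ℝ) (0 + L) := sub_toIcoDiv_zsmul_mem_Ico hL 0 x
    have e := AddCircle.liftIco_coe_apply (f := f) hx
    rw [hp.sub_zsmul_eq] at e
    rw [← e]
    congr 1
    rw [AddCircle.coe_sub, (AddCircle.coe_eq_zero_iff L).2 ⟨_, rfl⟩, sub_zero]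
  rw [h2]
  exact h1.comp (AddCircle.continuous_mk' L)

/-! ### The pointwise inequality -/

/-- Young's inequality by dichotomy: if t ≤ ηs, the positive power of t supplies a small factor;
otherwise s ≤ t/η and the whole product is a multiple of a power of t. -/
lemma young_pow {ε M : ℝ} (hε : 0 < ε) (hM : 0 ≤ M) (i j : ℕ) (hj : j ≠ 0) :
    ∃ K : ℝ, 0 ≤ K ∧ ∀ s t : ℝ, 0 ≤ s → 0 ≤ t →
      M * (s ^ i * t ^ j) ≤ ε * s ^ (i + j) + K * t ^ (i + j) := by
  -- Dividing by M + 1 allows M = 0; capping η at 1 below gives η^j ≤ η.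
  set δ := ε / (M + 1)
  have hδ : 0 < δ := by positivity
  have hMδ : M * δ ≤ ε := by
    have : (M + 1) * δ = ε := mul_div_cancel₀ _ (by positivity)
    linarith
  set η := min δ 1
  have hη : 0 < η := lt_min hδ one_pos
  refine ⟨M * (1 / η) ^ i, by positivity, fun s t hs ht => ?_⟩
  rcases le_total t (η * s) with h | h
  · have h1 : η ^ j ≤ δ := (pow_le_of_le_one hη.le (min_le_right _ _) hj).trans (min_le_left _ _)
    calc M * (s ^ i * t ^ j) ≤ M * (s ^ i * (η * s) ^ j) := by gcongr
      _ = M * η ^ j * s ^ (i + j) := by rw [mul_pow, pow_add]; ring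
      _ ≤ M * δ * s ^ (i + j) := by gcongr
      _ ≤ ε * s ^ (i + j) := by gcongr
      _ ≤ _ := le_add_of_nonneg_right (by positivity)
  · have h1 : s ≤ 1 / η * t := by
      rw [one_div, ← div_eq_inv_mul, le_div_iff₀ hη]; linarith
    calc M * (s ^ i * t ^ j) ≤ M * ((1 / η * t) ^ i * t ^ j) := by gcongr
      _ = M * (1 / η) ^ i * t ^ (i + j) := by rw [mul_pow, pow_add]; ring
      _ ≤ _ := le_add_of_nonneg_left (by positivity)

/-- The density, relative to `u ^ (n + 2)`, of the total derivative
`(ζ⁶ u ^ (n + 2) (-(n - 2) / 5 r⁵ + r³ q + r q |q| / 4))'`, where `r = u' / u`, `q = u'' / u`,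
in terms of `a = ζ r`, `b = ζ² q`, `c = ζ³ u''' / u` and `y = ζ'`. -/
noncomputable def bernisForm (n a b c y : ℝ) : ℝ :=
  6 * y * a ^ 3 * b - 6 * (n - 2) / 5 * (y * a ^ 5) + (n - 2) * (3 - n) / 5 * a ^ 6
    + 3 * a ^ 2 * b ^ 2 + a ^ 3 * c
    + 1 / 4 * (6 * y * a * (b * |b|) + (n - 1) * a ^ 2 * (b * |b|) + b ^ 2 * |b|
      + 2 * a * |b| * c)

/-- The good terms are μa⁶, 3a²b² and |b|³/4. All terms are homogeneous of degree 6 when a, y, b, c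
have degrees 1, 1, 2, 3, so Young's inequality applies to each mixed one. Four of its uses cost μ/8
of a⁶ each, one costs half of |b|³/4, and the a²b² losses are 1 + 1/2 + 1/4 < 3. -/
lemma exists_le_bernisForm {n : ℝ} (hn : n ∈ Set.Ioo (2 : ℝ) 3) :
    ∃ C D : ℝ, 0 < C ∧ 0 < D ∧ ∀ a b c y : ℝ,
      a ^ 6 + |b| ^ 3 ≤ C * (c ^ 2 + y ^ 6) + D * bernisForm n a b c y := by
  obtain ⟨hn2, hn3⟩ := hn
  set μ := (n - 2) * (3 - n) / 5 with hμdef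
  have hμ : 0 < μ := by
    have := mul_pos (sub_pos.2 hn2) (sub_pos.2 hn3); positivity
  have hμ4 : μ ≤ 1 / 4 := by rw [hμdef]; nlinarith [sq_nonneg (n - 5 / 2)]
  have hμ8 : 0 < μ / 8 := by positivity
  obtain ⟨K₁, hK₁, h₁⟩ := young_pow hμ8 zero_le_one 1 1 one_ne_zero
  obtain ⟨K₂, hK₂, h₂⟩ := young_pow hμ8 (M := 9) (by norm_num) 4 2 two_ne_zero
  obtain ⟨K₃, hK₃, h₃⟩ := young_pow hμ8 (M := 2) (by norm_num) 5 1 one_ne_zero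
  obtain ⟨K₄, hK₄, h₄⟩ := young_pow (ε := 1 / 8) (by norm_num) (M := 3 / 2) (by norm_num) 2 1
    one_ne_zero
  obtain ⟨K₅, hK₅, h₅⟩ := young_pow hμ8 hK₄ 3 3 three_ne_zero
  set K := K₁ + K₂ + K₃ + K₅ + 1
  refine ⟨2 / μ * K, 2 / μ, by positivity, by positivity, fun a b c y => ?_⟩
  suffices h : μ / 2 * a ^ 6 + 1 / 8 * |b| ^ 3 ≤ K * (c ^ 2 + y ^ 6) + bernisForm n a b c y by
    -- Since μ ≤ 1/4, a common factor μ/2 can be taken out of both surviving terms; this explains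
    -- the factor 2/μ in the witnesses.
    have hb : μ / 2 * |b| ^ 3 ≤ 1 / 8 * |b| ^ 3 :=
      mul_le_mul_of_nonneg_right (by linarith) (by positivity)
    have h' : μ / 2 * (a ^ 6 + |b| ^ 3) ≤ K * (c ^ 2 + y ^ 6) + bernisForm n a b c y := by linarith
    calc a ^ 6 + |b| ^ 3 = 2 / μ * (μ / 2 * (a ^ 6 + |b| ^ 3)) := by field_simp
      _ ≤ 2 / μ * (K * (c ^ 2 + y ^ 6) + bernisForm n a b c y) := by gcongr
      _ = _ := by ring
  have ha0 := abs_nonneg a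
  have hb0 := abs_nonneg b
  have hc0 := abs_nonneg c
  have hy0 := abs_nonneg y
  have e₁ : -(|a| ^ 3 * |c|) ≤ a ^ 3 * c := by
    rw [← abs_pow, ← abs_mul]; exact neg_abs_le _
  have e₂ : -(|y| * |a| ^ 3 * |b|) ≤ y * a ^ 3 * b := by
    rw [← abs_pow, ← abs_mul, ← abs_mul]; exact neg_abs_le _
  have e₃ : y * a ^ 5 ≤ |y| * |a| ^ 5 := by
    rw [← abs_pow, ← abs_mul]; exact le_abs_self _
  have e₄ : -(|y| * |a| * (|b| * |b|)) ≤ y * a * (b * |b|) := by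
    have : |y| * |a| * (|b| * |b|) = |y * a * (b * |b|)| := by simp [abs_mul]
    rw [this]; exact neg_abs_le _
  have e₅ : -(|a| ^ 2 * |b| ^ 2) ≤ a ^ 2 * (b * |b|) := by
    have : |a| ^ 2 * |b| ^ 2 = |a ^ 2 * (b * |b|)| := by rw [abs_mul, abs_mul, abs_pow, abs_abs]; ring
    rw [this]; exact neg_abs_le _
  have e₆ : -(|a| * |b| * |c|) ≤ a * |b| * c := by
    have : |a| * |b| * |c| = |a * |b| * c| := by simp [abs_mul]
    rw [this]; exact neg_abs_le _
  have y₁ := h₁ (|a| ^ 3) |c| (by positivity) hc0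
  have y₂ := h₂ |a| |y| ha0 hy0
  have y₃ := h₃ |a| |y| ha0 hy0
  -- The term |y||a|b² is split twice: first into |b|³ and (|a||y|)³, then, by `y₅`, the latter into
  -- a⁶ and y⁶.
  have y₄ := h₄ |b| (|a| * |y|) hb0 (by positivity)
  have y₅ := h₅ |a| |y| ha0 hy0
  have y₆ : 6 * (|y| * |a| ^ 3 * |b|) ≤ |a| ^ 2 * |b| ^ 2 + 9 * (|a| ^ 4 * |y| ^ 2) := by
    nlinarith [sq_nonneg (|a| * |b| - 3 * (|a| ^ 2 * |y|))]
  have y₇ : 2 * (|a| * |b| * |c|) ≤ |a| ^ 2 * |b| ^ 2 + |c| ^ 2 := by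
    nlinarith [sq_nonneg (|a| * |b| - |c|)]
  have f₃ : 6 * (n - 2) / 5 * (y * a ^ 5) ≤ 2 * (|a| ^ 5 * |y| ^ 1) := by
    have : 6 * (n - 2) / 5 * (y * a ^ 5) ≤ 6 * (n - 2) / 5 * (|y| * |a| ^ 5) := by
      gcongr
    have h' : 6 * (n - 2) / 5 * (|y| * |a| ^ 5) ≤ 2 * (|y| * |a| ^ 5) := by gcongr; linarith
    linarith
  have f₅ : -(2 * (|a| ^ 2 * |b| ^ 2)) ≤ (n - 1) * (a ^ 2 * (b * |b|)) := by
    have h' : (n - 1) * -(|a| ^ 2 * |b| ^ 2) ≤ (n - 1) * (a ^ 2 * (b * |b|)) := by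
      gcongr; linarith
    have h'' : (n - 1) * (|a| ^ 2 * |b| ^ 2) ≤ 2 * (|a| ^ 2 * |b| ^ 2) := by gcongr; linarith
    linarith
  have p₁ : 0 ≤ |a| ^ 2 * |b| ^ 2 := by positivity
  have A6 : |a| ^ 6 = a ^ 6 := by rw [← abs_pow, abs_of_nonneg (by positivity)]
  have Y6 : |y| ^ 6 = y ^ 6 := by rw [← abs_pow, abs_of_nonneg (by positivity)]
  have k₁ : 0 ≤ (K₂ + K₃ + K₅ + 1) * c ^ 2 := by positivity
  have k₂ : 0 ≤ (K₁ + 1) * y ^ 6 := by positivity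
  norm_num at y₁ y₂ y₃ y₄ y₅
  simp only [← pow_mul, mul_pow, sq_abs] at *
  norm_num at y₁ y₄
  rw [A6] at *
  rw [Y6] at *
  have hb3 : b ^ 2 * |b| = |b| ^ 3 := by rw [← sq_abs b]; ring
  have hK : K * (c ^ 2 + y ^ 6) = K₁ * c ^ 2 + (K₂ + K₃ + K₅ + 1) * c ^ 2
    + (K₂ + K₃ + K₅) * y ^ 6 + (K₁ + 1) * y ^ 6 := by ring
  have hbb : |b| * |b| = b ^ 2 := by rw [← sq, sq_abs]
  rw [hbb] at e₄
  rw [hK]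
  unfold bernisForm
  rw [hb3, ← hμdef]
  have hc2 : c ^ 2 ≤ (K₂ + K₃ + K₅ + 1) * c ^ 2 := by
    have : 0 ≤ (K₂ + K₃ + K₅) * c ^ 2 := by positivity
    linarith
  linarith

/-! ### The integral inequality for positive periodic functions -/

section Positive

variable {u u₁ u₂ w : ℝ → ℝ}

/-- In the variables r, q, p differentiation closes up: r' = q - r², q' = p - qr, (u^m)' = m u^m r.
All later derivatives are computed from these rules. -/
lemma hasDerivAt_ratio (hpos : ∀ x, 0 < u x) (h₁ : ∀ x, HasDerivAt u (u₁ x) x)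
    (h₂ : ∀ x, HasDerivAt u₁ (u₂ x) x) (x : ℝ) :
    HasDerivAt (fun x => u₁ x / u x) (u₂ x / u x - (u₁ x / u x) ^ 2) x := by
  have hx := (hpos x).ne'
  refine ((h₂ x).div (h₁ x) hx).congr_deriv ?_
  field_simp

lemma hasDerivAt_rpow (hpos : ∀ x, 0 < u x) (h₁ : ∀ x, HasDerivAt u (u₁ x) x) (m x : ℝ) :
    HasDerivAt (fun x => u x ^ m) (m * u x ^ m * (u₁ x / u x)) x := by
  refine ((h₁ x).rpow_const (Or.inl (hpos x).ne')).congr_deriv ?_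
  rw [Real.rpow_sub_one (hpos x).ne']
  ring

lemma continuous_of_hasDerivAt {f g : ℝ → ℝ} (h : ∀ x, HasDerivAt f (g x) x) : Continuous f :=
  continuous_iff_continuousAt.2 fun x => (h x).continuousAt

lemma locallyAC_ratio (hpos : ∀ x, 0 < u x) (h₁ : ∀ x, HasDerivAt u (u₁ x) x)
    (h₂ : ∀ x, HasDerivAt u₁ (u₂ x) x) (hw : LocallyAC u₂ w) :
    LocallyAC (fun x => u₁ x / u x) (fun x => u₂ x / u x - (u₁ x / u x) ^ 2) := by
  refine .of_hasDerivAt (hasDerivAt_ratio hpos h₁ h₂) ?_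
  have c₀ := continuous_of_hasDerivAt h₁
  have c₁ := continuous_of_hasDerivAt h₂
  exact (hw.continuous.div c₀ fun x => (hpos x).ne').sub
    ((c₁.div c₀ fun x => (hpos x).ne').pow 2)

lemma locallyAC_rpow (hpos : ∀ x, 0 < u x) (h₁ : ∀ x, HasDerivAt u (u₁ x) x)
    (h₂ : ∀ x, HasDerivAt u₁ (u₂ x) x) (m : ℝ) :
    LocallyAC (fun x => u x ^ m) (fun x => m * u x ^ m * (u₁ x / u x)) := by
  refine .of_hasDerivAt (hasDerivAt_rpow hpos h₁ m) ?_
  have c₀ := continuous_of_hasDerivAt h₁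
  have c₁ := continuous_of_hasDerivAt h₂
  exact (continuous_const.mul (c₀.rpow_const fun x => Or.inl (hpos x).ne')).mul
    (c₁.div c₀ fun x => (hpos x).ne')

lemma locallyAC_second_ratio (hpos : ∀ x, 0 < u x) (h₁ : ∀ x, HasDerivAt u (u₁ x) x)
    (h₂ : ∀ x, HasDerivAt u₁ (u₂ x) x) (hw : LocallyAC u₂ w) :
    LocallyAC (fun x => u₂ x / u x) (fun x => w x / u x - u₂ x / u x * (u₁ x / u x)) := by
  have hinv : LocallyAC (fun x => (u x)⁻¹) (fun x => -u₁ x / u x ^ 2) :=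
    .of_hasDerivAt (fun x => (h₁ x).inv (hpos x).ne')
      ((continuous_of_hasDerivAt h₂).neg.div ((continuous_of_hasDerivAt h₁).pow 2)
        fun x => pow_ne_zero 2 (hpos x).ne')
  refine (hw.mul hinv).congr fun x => ?_
  have := (hpos x).ne'
  field_simp
  ring

/-- The first three derivatives of a power of a positive function. -/
lemma locallyAC_rpow_chain (hpos : ∀ x, 0 < u x) (h₁ : ∀ x, HasDerivAt u (u₁ x) x)
    (h₂ : ∀ x, HasDerivAt u₁ (u₂ x) x) (hw : LocallyAC u₂ w) (m : ℝ) :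
    LocallyAC (fun x => u x ^ m) (fun x => m * (u x ^ m * (u₁ x / u x))) ∧
    LocallyAC (fun x => m * (u x ^ m * (u₁ x / u x)))
      (fun x => m * (u x ^ m * (u₂ x / u x + (m - 1) * (u₁ x / u x) ^ 2))) ∧
    LocallyAC (fun x => m * (u x ^ m * (u₂ x / u x + (m - 1) * (u₁ x / u x) ^ 2)))
      (fun x => m * (u x ^ m * (w x / u x + 3 * (m - 1) * (u₁ x / u x * (u₂ x / u x))
        + (m - 1) * (m - 2) * (u₁ x / u x) ^ 3))) := by
  have hU := locallyAC_rpow hpos h₁ h₂ m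
  have hr := locallyAC_ratio hpos h₁ h₂ hw
  have hq := locallyAC_second_ratio hpos h₁ h₂ hw
  refine ⟨hU.congr fun x => by ring, ((hU.mul hr).const_mul m).congr fun x => by ring,
    ((hU.mul (hq.add ((hr.pow 2).const_mul (m - 1)))).const_mul m).congr fun x => ?_⟩
  simp only [show (2 : ℕ) - 1 = 1 from rfl]
  push_cast
  ring

lemma periodic_deriv {f g : ℝ → ℝ} {L : ℝ} (hf : Function.Periodic f L)
    (h : ∀ x, HasDerivAt f (g x) x) : Function.Periodic g L := fun x => by
  have h1 : HasDerivAt f (g (x + L)) x := by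
    have := (h (x + L)).comp_add_const x L
    rwa [show (fun x => f (x + L)) = f from funext hf] at this
  exact h1.unique (h x)

/-- The integrand is almost everywhere the derivative of an absolutely continuous function built
from ζ, u, u', u'' alone, whose values at 0 and L agree by periodicity. -/
lemma integral_bernisForm_eq_zero {n L : ℝ} (hpos : ∀ x, 0 < u x) (hper : Function.Periodic u L)
    (h₁ : ∀ x, HasDerivAt u (u₁ x) x) (h₂ : ∀ x, HasDerivAt u₁ (u₂ x) x) (hw : LocallyAC u₂ w)
    {ζ : ℝ → ℝ} (hζ : Function.Periodic ζ L) {K : ℝ≥0} (hK : LipschitzWith K ζ) :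
    let ψ := fun x => u x ^ (n + 2) * bernisForm n (ζ x * (u₁ x / u x)) (ζ x ^ 2 * (u₂ x / u x))
      (ζ x ^ 3 * (w x / u x)) (deriv ζ x)
    IntervalIntegrable ψ volume 0 L ∧ ∫ x in (0 : ℝ)..L, ψ x = 0 := by
  intro ψ
  have hU := locallyAC_rpow hpos h₁ h₂ (n + 2)
  have hr := locallyAC_ratio hpos h₁ h₂ hw
  have hq := locallyAC_second_ratio hpos h₁ h₂ hw
  have hF : LocallyAC _ ψ := (((LocallyAC.of_lipschitzWith hK).pow 6).mul (hU.mul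
    (((hr.pow 5).const_mul (-(n - 2) / 5)).add
      (((hr.pow 3).mul hq).add ((hr.mul hq.mul_abs).const_mul (1 / 4)))))).congr fun x => by
      simp only [ψ, bernisForm, abs_mul, abs_pow, sq_abs]
      norm_num
      ring
  refine ⟨hF.intervalIntegrable 0 L, ?_⟩
  rw [hF.integral_eq_sub]
  have p₁ := periodic_deriv hper h₁
  have p₂ := periodic_deriv p₁ h₂
  have e₀ := hper 0
  have e₁ := p₁ 0
  have e₂ := p₂ 0
  have eζ := hζ 0
  rw [zero_add] at e₀ e₁ e₂ eζ
  simp only [e₀, e₁, e₂, eζ, sub_self]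

/-- The weighted inequality that controls `u'⁶ / u⁶` and `|u''|³ / u³` with weight `u ^ (n + 2)`. -/
lemma bernis_core {n : ℝ} (hn : n ∈ Set.Ioo (2 : ℝ) 3) :
    ∃ C : ℝ≥0, ∀ (L : ℝ) (u u₁ u₂ w ζ : ℝ → ℝ) (K : ℝ≥0), 0 < L → (∀ x, 0 < u x) →
      Function.Periodic u L → (∀ x, HasDerivAt u (u₁ x) x) → (∀ x, HasDerivAt u₁ (u₂ x) x) →
      LocallyAC u₂ w → Function.Periodic ζ L → LipschitzWith K ζ →
      ∫⁻ x in Set.Ioo 0 L, ENNReal.ofReal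
          (ζ x ^ 6 * (u x ^ (n + 2) * ((u₁ x / u x) ^ 6 + |u₂ x / u x| ^ 3))) ≤
        bernisBound C n L ζ u w := by
  obtain ⟨C, D, hC, hD, hineq⟩ := exists_le_bernisForm hn
  refine ⟨C.toNNReal, ?_⟩
  intro L u u₁ u₂ w ζ K hL hpos hper h₁ h₂ hw hζ hK
  have hset : Set.Ioo 0 L ∩ {x | 0 < u x} = Set.Ioo 0 L :=
    Set.inter_eq_left.2 fun x _ => hpos x
  unfold bernisBound
  rw [hset]
  set Y₁ : ℝ → ℝ := fun x => ζ x ^ 6 * u x ^ n * |w x| ^ 2 with hY₁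
  set Y₂ : ℝ → ℝ := fun x => |deriv ζ x| ^ 6 * u x ^ (n + 2) with hY₂
  set X : ℝ → ℝ := fun x => ζ x ^ 6 * (u x ^ (n + 2) * ((u₁ x / u x) ^ 6 + |u₂ x / u x| ^ 3)) with hX
  have hC0 : (C.toNNReal : ℝ≥0∞) ≠ 0 := by simpa using hC
  -- If a right-hand integral is infinite there is nothing to prove; otherwise all quantities are
  -- integrable and the comparison can be made with real integrals.
  by_cases t₁ : ∫⁻ x in Set.Ioo 0 L, ENNReal.ofReal (Y₁ x) = ⊤
  · rw [t₁, ENNReal.mul_top hC0, top_add]; exact le_top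
  by_cases t₂ : ∫⁻ x in Set.Ioo 0 L, ENNReal.ofReal (Y₂ x) = ⊤
  · rw [t₂, ENNReal.mul_top hC0, add_top]; exact le_top
  have c₀ := continuous_of_hasDerivAt h₁
  have c₁ := continuous_of_hasDerivAt h₂
  have c₂ := hw.continuous
  have hu0 : ∀ x, u x ≠ 0 := fun x => (hpos x).ne'
  have cpow : ∀ m : ℝ, Continuous fun x => u x ^ m := fun m =>
    c₀.rpow_const fun x => Or.inl (hu0 x)
  have hwm : AEStronglyMeasurable w volume := hw.locallyIntegrable.aestronglyMeasurable
  have hY₁m : AEStronglyMeasurable Y₁ volume :=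
    ((hK.continuous.pow 6).mul (cpow n)).aestronglyMeasurable.mul (hwm.norm.pow 2)
  have hY₂m : AEStronglyMeasurable Y₂ volume :=
    ((measurable_deriv ζ).aestronglyMeasurable.norm.pow 6).mul (cpow (n + 2)).aestronglyMeasurable
  have pos : ∀ (m x : ℝ), 0 ≤ u x ^ m := fun m x => (Real.rpow_pos_of_pos (hpos x) m).le
  have n₁ : ∀ x, 0 ≤ Y₁ x := fun x => by have := pos n x; positivity
  have n₂ : ∀ x, 0 ≤ Y₂ x := fun x => by have := pos (n + 2) x; positivity
  have nX : ∀ x, 0 ≤ X x := fun x => by have := pos (n + 2) x; positivity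
  have i₁ : Integrable Y₁ (volume.restrict (Set.Ioo 0 L)) :=
    ⟨hY₁m.restrict, (hasFiniteIntegral_iff_ofReal (.of_forall n₁)).2 (lt_top_iff_ne_top.2 t₁)⟩
  have i₂ : Integrable Y₂ (volume.restrict (Set.Ioo 0 L)) :=
    ⟨hY₂m.restrict, (hasFiniteIntegral_iff_ofReal (.of_forall n₂)).2 (lt_top_iff_ne_top.2 t₂)⟩
  have cX : Continuous X :=
    (hK.continuous.pow 6).mul ((cpow (n + 2)).mul (((c₁.div c₀ hu0).pow 6).add
      ((c₂.div c₀ hu0).abs.pow 3)))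
  have iX : Integrable X (volume.restrict (Set.Ioo 0 L)) :=
    (cX.integrableOn_Icc (a := 0) (b := L)).mono_set Set.Ioo_subset_Icc_self
  obtain ⟨iψ, hψ⟩ := integral_bernisForm_eq_zero (n := n) hpos hper h₁ h₂ hw hζ hK
  set ψ := fun x => u x ^ (n + 2) * bernisForm n (ζ x * (u₁ x / u x)) (ζ x ^ 2 * (u₂ x / u x))
      (ζ x ^ 3 * (w x / u x)) (deriv ζ x)
  rw [intervalIntegral.integral_of_le hL.le, integral_Ioc_eq_integral_Ioo] at hψ
  have iψ' : Integrable ψ (volume.restrict (Set.Ioo 0 L)) :=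
    ((intervalIntegrable_iff_integrableOn_Ioo_of_le hL.le).1 iψ)
  have hle : ∀ x, X x ≤ C * Y₁ x + C * Y₂ x + D * ψ x := by
    intro x
    have h := mul_le_mul_of_nonneg_left (hineq (ζ x * (u₁ x / u x)) (ζ x ^ 2 * (u₂ x / u x))
      (ζ x ^ 3 * (w x / u x)) (deriv ζ x)) (pos (n + 2) x)
    have eX : X x = u x ^ (n + 2) * ((ζ x * (u₁ x / u x)) ^ 6 + |ζ x ^ 2 * (u₂ x / u x)| ^ 3) := by
      simp only [hX, abs_mul, abs_pow, sq_abs]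
      ring
    have eY₁ : Y₁ x = u x ^ (n + 2) * (ζ x ^ 3 * (w x / u x)) ^ 2 := by
      simp only [hY₁, sq_abs, Real.rpow_add (hpos x), Real.rpow_two]
      have := hu0 x
      field_simp
    have eY₂ : Y₂ x = u x ^ (n + 2) * deriv ζ x ^ 6 := by
      have : |deriv ζ x| ^ 6 = deriv ζ x ^ 6 := by rw [← abs_pow, abs_of_nonneg (by positivity)]
      simp only [hY₂, this]
      ring
    rw [eX, eY₁, eY₂]
    refine h.trans (le_of_eq ?_)
    simp only [ψ]
    ring
  have hint : ∫ x in Set.Ioo 0 L, X x ≤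
      C * (∫ x in Set.Ioo 0 L, Y₁ x) + C * ∫ x in Set.Ioo 0 L, Y₂ x := by
    calc ∫ x in Set.Ioo 0 L, X x ≤ ∫ x in Set.Ioo 0 L, (C * Y₁ x + C * Y₂ x + D * ψ x) :=
          integral_mono iX (((i₁.const_mul C).add (i₂.const_mul C)).add (iψ'.const_mul D)) hle
      _ = _ := by
        rw [integral_add (f := fun x => C * Y₁ x + C * Y₂ x)
            ((i₁.const_mul C).add (i₂.const_mul C)) (iψ'.const_mul D),
          integral_add (i₁.const_mul C) (i₂.const_mul C), integral_const_mul, integral_const_mul,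
          integral_const_mul, hψ, mul_zero, add_zero]
  rw [← ofReal_integral_eq_lintegral_ofReal iX (.of_forall nX),
    ← ofReal_integral_eq_lintegral_ofReal i₁ (.of_forall n₁),
    ← ofReal_integral_eq_lintegral_ofReal i₂ (.of_forall n₂)]
  refine (ENNReal.ofReal_le_ofReal hint).trans (le_of_eq ?_)
  rw [ENNReal.ofReal_add (mul_nonneg hC.le (integral_nonneg n₁))
    (mul_nonneg hC.le (integral_nonneg n₂)), ENNReal.ofReal_mul hC.le, ENNReal.ofReal_mul hC.le]
  rfl

end Positive

/-! ### From the core inequality to powers of u -/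

lemma abs_mul_add_sq_pow_three_le {m r q : ℝ} (hm : m ∈ Set.Icc (0 : ℝ) 2) :
    |m * (q + (m - 1) * r ^ 2)| ^ 3 ≤ 32 * (r ^ 6 + |q| ^ 3) := by
  have h1 : |m - 1| ≤ 1 := abs_le.2 ⟨by linarith [hm.1], by linarith [hm.2]⟩
  have h2 : |m * (q + (m - 1) * r ^ 2)| ≤ 2 * (|q| + r ^ 2) := by
    rw [abs_mul, abs_of_nonneg hm.1]
    refine mul_le_mul hm.2 ((abs_add_le _ _).trans ?_) (abs_nonneg _) zero_le_two
    rw [abs_mul, abs_of_nonneg (sq_nonneg r)]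
    have := mul_le_mul_of_nonneg_right h1 (sq_nonneg r)
    linarith
  have hq := abs_nonneg q
  have hr := sq_nonneg r
  -- This is the defect in (A + B)³ ≤ 4(A³ + B³), up to a factor 3; with the factor 2³ it gives 32.
  have h3 : 0 ≤ (|q| + r ^ 2) * (|q| - r ^ 2) ^ 2 := by positivity
  calc |m * (q + (m - 1) * r ^ 2)| ^ 3 ≤ (2 * (|q| + r ^ 2)) ^ 3 := by gcongr
    _ ≤ _ := by nlinarith [h3]

/-- The square of a sum of three terms costs a factor 3, and r²q² is controlled by comparing r² with
|q|. The constants round up 25/4 · 3 · (21 + 1) = 412.5 and 25/4 · 3 = 18.75. -/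
lemma abs_third_sq_le {m r q p : ℝ} (hm : m ∈ Set.Icc (2 : ℝ) (5 / 2)) :
    |m * (p + 3 * (m - 1) * (r * q) + (m - 1) * (m - 2) * r ^ 3)| ^ 2
      ≤ 440 * (r ^ 6 + |q| ^ 3) + 20 * p ^ 2 := by
  obtain ⟨h2, h3⟩ := hm
  have hrq : r ^ 2 * q ^ 2 ≤ r ^ 6 + |q| ^ 3 := by
    rw [← sq_abs q]
    have hq := abs_nonneg q
    have hr := sq_nonneg r
    rcases le_total (r ^ 2) |q| with h | h
    · have := mul_le_mul_of_nonneg_right h (sq_nonneg |q|)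
      have : 0 ≤ r ^ 6 := by positivity
      linarith
    · have : r ^ 2 * |q| ^ 2 ≤ r ^ 2 * (r ^ 2) ^ 2 := by gcongr
      have : 0 ≤ |q| ^ 3 := by positivity
      linarith
  set s := 3 * (m - 1)
  set t := (m - 1) * (m - 2)
  have hm2 : m ^ 2 ≤ 25 / 4 := by nlinarith
  have hs : s ^ 2 ≤ 21 := by simp only [s]; nlinarith
  have ht : t ^ 2 ≤ 1 := by
    have : 0 ≤ t := mul_nonneg (by linarith) (by linarith)
    have : t ≤ 1 := by simp only [t]; nlinarith
    nlinarith
  rw [sq_abs, mul_pow]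
  have hsq : (p + s * (r * q) + t * r ^ 3) ^ 2
      ≤ 3 * (p ^ 2 + s ^ 2 * (r ^ 2 * q ^ 2) + t ^ 2 * r ^ 6) := by
    nlinarith [sq_nonneg (p - s * (r * q)), sq_nonneg (p - t * r ^ 3),
      sq_nonneg (s * (r * q) - t * r ^ 3)]
  have h1 : s ^ 2 * (r ^ 2 * q ^ 2) ≤ 21 * (r ^ 2 * q ^ 2) := by gcongr
  have h4 : t ^ 2 * r ^ 6 ≤ 1 * r ^ 6 := by gcongr
  have hq3 : 0 ≤ |q| ^ 3 := by positivity
  have hr6 : 0 ≤ r ^ 6 := by positivity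
  calc m ^ 2 * (p + s * (r * q) + t * r ^ 3) ^ 2
      ≤ 25 / 4 * (3 * (p ^ 2 + s ^ 2 * (r ^ 2 * q ^ 2) + t ^ 2 * r ^ 6)) := by gcongr
    _ ≤ _ := by nlinarith [sq_nonneg p]

/-- Weighted Bernis inequalities for a positive periodic function with a third weak derivative. -/
theorem bernis_of_hasWeakDeriv {n : ℝ} (hn : n ∈ Set.Ioo (2 : ℝ) 3) :
    ∃ C : ℝ≥0, ∀ (L : ℝ) (u w : ℝ → ℝ), 0 < L → Continuous u → Function.Periodic u L →
      (∀ x, 0 < u x) → HasWeakDeriv 3 Set.univ u w → ∃ w₁ w₂ w₃ : ℝ → ℝ,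
        HasWeakDeriv 1 Set.univ (fun x => u x ^ ((n + 2) / 6)) w₁ ∧
        HasWeakDeriv 2 Set.univ (fun x => u x ^ ((n + 2) / 3)) w₂ ∧
        HasWeakDeriv 3 Set.univ (fun x => u x ^ ((n + 2) / 2)) w₃ ∧
        ∀ ζ : ℝ → ℝ, Function.Periodic ζ L → (∃ K : ℝ≥0, LipschitzWith K ζ) →
          ∫⁻ x in Set.Ioo 0 L, ENNReal.ofReal (ζ x ^ 6 * |w₁ x| ^ 6) ≤ bernisBound C n L ζ u w ∧
          ∫⁻ x in Set.Ioo 0 L, ENNReal.ofReal (ζ x ^ 6 * |w₂ x| ^ 3) ≤ bernisBound C n L ζ u w ∧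
          ∫⁻ x in Set.Ioo 0 L, ENNReal.ofReal (ζ x ^ 6 * |w₃ x| ^ 2) ≤ bernisBound C n L ζ u w := by
  obtain ⟨C, hC⟩ := bernis_core hn
  -- The 440 multiplies the core estimate, and the 20 accounts for p², which is already the first
  -- integral of the bound.
  refine ⟨440 * C + 20, fun L u w hL hu hper hpos hweak => ?_⟩
  obtain ⟨u₁, u₂, h₁, h₂, hw⟩ := hweak.regularity hu
  obtain ⟨a₁, -, -⟩ := locallyAC_rpow_chain hpos h₁ h₂ hw ((n + 2) / 6)
  obtain ⟨b₁, b₂, -⟩ := locallyAC_rpow_chain hpos h₁ h₂ hw ((n + 2) / 3)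
  obtain ⟨c₁, c₂, c₃⟩ := locallyAC_rpow_chain hpos h₁ h₂ hw ((n + 2) / 2)
  refine ⟨_, _, _, .of_locallyAC a₁, .succ_of_locallyAC b₁ (.of_locallyAC b₂),
    .succ_of_locallyAC c₁ (.succ_of_locallyAC c₂ (.of_locallyAC c₃)), ?_⟩
  rintro ζ hζ ⟨K, hK⟩
  have hcore := hC L u u₁ u₂ w ζ K hL hpos hper h₁ h₂ hw hζ hK
  have hset : Set.Ioo 0 L ∩ {x | 0 < u x} = Set.Ioo 0 L :=
    Set.inter_eq_left.2 fun x _ => hpos x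
  have hu0 : ∀ x, u x ≠ 0 := fun x => (hpos x).ne'
  -- Measurability of this summand suffices to split the lower integral below.
  have cX : Continuous fun x => ζ x ^ 6 * (u x ^ (n + 2) * ((u₁ x / u x) ^ 6 + |u₂ x / u x| ^ 3)) :=
    (hK.continuous.pow 6).mul ((hu.rpow_const fun x => Or.inl (hu0 x)).mul
      ((((continuous_of_hasDerivAt h₂).div hu hu0).pow 6).add
        ((hw.continuous.div hu hu0).abs.pow 3)))
  have key : ∀ Z : ℝ → ℝ, (∀ x, Z x ≤ u x ^ (n + 2) *
      (440 * ((u₁ x / u x) ^ 6 + |u₂ x / u x| ^ 3) + 20 * (w x / u x) ^ 2)) →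
      ∫⁻ x in Set.Ioo 0 L, ENNReal.ofReal (ζ x ^ 6 * Z x)
        ≤ bernisBound (440 * C + 20) n L ζ u w := by
    intro Z hZ
    have hpt : ∀ x, ENNReal.ofReal (ζ x ^ 6 * Z x) ≤
        440 * ENNReal.ofReal
          (ζ x ^ 6 * (u x ^ (n + 2) * ((u₁ x / u x) ^ 6 + |u₂ x / u x| ^ 3)))
        + 20 * ENNReal.ofReal (ζ x ^ 6 * u x ^ n * |w x| ^ 2) := by
      intro x
      have pU := (Real.rpow_pos_of_pos (hpos x) (n + 2)).le
      have pu := (Real.rpow_pos_of_pos (hpos x) n).le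
      rw [← ENNReal.ofReal_ofNat 440, ← ENNReal.ofReal_ofNat 20,
        ← ENNReal.ofReal_mul (by norm_num), ← ENNReal.ofReal_mul (by norm_num),
        ← ENNReal.ofReal_add (by positivity) (by positivity)]
      refine ENNReal.ofReal_le_ofReal ?_
      have e : u x ^ n * |w x| ^ 2 = u x ^ (n + 2) * (w x / u x) ^ 2 := by
        simp only [sq_abs, Real.rpow_add (hpos x), Real.rpow_two]
        have := hu0 x
        field_simp
      rw [mul_assoc (ζ x ^ 6) (u x ^ n), e]
      refine (mul_le_mul_of_nonneg_left (hZ x) (by positivity)).trans (le_of_eq ?_)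
      ring
    refine (lintegral_mono hpt).trans ?_
    rw [lintegral_add_left (cX.measurable.ennreal_ofReal.const_mul _), lintegral_const_mul' _ _ (by simp),
      lintegral_const_mul' _ _ (by simp)]
    refine (add_le_add_left (mul_le_mul_right hcore 440) _).trans ?_
    unfold bernisBound
    rw [hset]
    push_cast
    simp only [add_mul, mul_add, mul_assoc]
    set I := ∫⁻ x in Set.Ioo 0 L, ENNReal.ofReal (ζ x ^ 6 * (u x ^ n * |w x| ^ 2))
    set J := ∫⁻ x in Set.Ioo 0 L, ENNReal.ofReal (|deriv ζ x| ^ 6 * u x ^ (n + 2))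
    calc 440 * (C * I) + 440 * (C * J) + 20 * I
        = 440 * (C * I) + 20 * I + 440 * (C * J) := by ring
      _ ≤ _ := by gcongr; exact le_self_add
  have hpow : ∀ (m x : ℝ) (k : ℕ), m * k = n + 2 → (u x ^ m) ^ k = u x ^ (n + 2) := by
    intro m x k h
    rw [← Real.rpow_mul_natCast (hpos x).le, h]
  obtain ⟨hn2, hn3⟩ := hn
  have bound : ∀ (m A B x : ℝ) (k : ℕ), m * k = n + 2 → |m * A| ^ k ≤ B →
      |m * (u x ^ m * A)| ^ k ≤ u x ^ (n + 2) * B := by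
    intro m A B x k hk h
    have pm := (Real.rpow_pos_of_pos (hpos x) m).le
    rw [show m * (u x ^ m * A) = u x ^ m * (m * A) by ring, abs_mul, mul_pow, abs_of_nonneg pm,
      hpow m x k hk]
    exact mul_le_mul_of_nonneg_left h (Real.rpow_pos_of_pos (hpos x) _).le
  refine ⟨key _ fun x => bound _ _ _ x 6 (by push_cast; ring) ?_,
    key _ fun x => bound _ _ _ x 3 (by push_cast; ring) ?_,
    key _ fun x => bound _ _ _ x 2 (by push_cast; ring) ?_⟩
  · have hr : 0 ≤ (u₁ x / u x) ^ 6 := by positivity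
    have hq : 0 ≤ |u₂ x / u x| ^ 3 := by positivity
    have hm : |(n + 2) / 6| ^ 6 ≤ 1 :=
      pow_le_one₀ (abs_nonneg _) (abs_le.2 ⟨by linarith, by linarith⟩)
    have habs : |u₁ x / u x| ^ 6 = (u₁ x / u x) ^ 6 := by
      rw [← abs_pow, abs_of_nonneg hr]
    rw [abs_mul, mul_pow, habs]
    have := mul_le_mul_of_nonneg_right hm hr
    linarith [sq_nonneg (w x / u x)]
  · refine (abs_mul_add_sq_pow_three_le ⟨by linarith, by linarith⟩).trans ?_
    have hr : 0 ≤ (u₁ x / u x) ^ 6 := by positivity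
    have hq : 0 ≤ |u₂ x / u x| ^ 3 := by positivity
    linarith [sq_nonneg (w x / u x)]
  · exact abs_third_sq_le ⟨by linarith, by linarith⟩

/-! ### Application to the paths of a solution -/

lemma continuousOn_of_hoelder {f : ℝ → ℝ} {s : Set ℝ} {K γ : ℝ} (hγ : 0 < γ)
    (h : ∀ x ∈ s, ∀ y ∈ s, |f x - f y| ≤ K * |x - y| ^ γ) : ContinuousOn f s := by
  intro y hy
  rw [ContinuousWithinAt, tendsto_iff_dist_tendsto_zero]
  have hlim : Tendsto (fun x => K * |x - y| ^ γ) (𝓝[s] y) (𝓝 0) := by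
    have hc : Continuous fun x => K * |x - y| ^ γ :=
      continuous_const.mul ((continuous_id.sub continuous_const).abs.rpow_const
        fun _ => Or.inr hγ.le)
    exact (hc.tendsto' y 0 (by simp [hγ.ne'])).mono_left nhdsWithin_le_nhds
  refine squeeze_zero' (.of_forall fun _ => dist_nonneg) ?_ hlim
  filter_upwards [self_mem_nhdsWithin] with x hx using h x hx y hy

end ThinFilm

theorem proposition3p3 (n : ℝ) (hn : n ∈ Set.Ioo (2 : ℝ) 3) :
    ∃ C : ℝ≥0, ∀ (L T δ γ S : ℝ) (lam : ℤ → ℝ) (Λ : Measure (ThinFilm.H1per L)),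
      0 < L → 0 < T → 0 < δ → γ ∈ Set.Ioo (0 : ℝ) (1 / 2) →
      ThinFilm.IsNoiseSpectrum lam →
      ThinFilm.cStrat n L lam * (3 / (2 : ℝ) ^ (n - 4)) * ((n - 2) / (3 - n)) < S →
      ThinFilm.IsInitialLaw Λ →
      ∀ (Ω : Type*) (mΩ : MeasurableSpace Ω) (P : Measure Ω) (_ : IsProbabilityMeasure P)
        (sol : ThinFilm.MartingaleSolution P n L T δ γ S lam Λ),
      ∀ᵐ ω ∂P, ∀ᵐ t : ThinFilm.Time T, ∃ w₁ w₂ w₃ : ℝ → ℝ,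
        ThinFilm.HasWeakDeriv 1 Set.univ (fun x => sol.u t ω x ^ ((n + 2) / 6)) w₁ ∧
        ThinFilm.HasWeakDeriv 2 Set.univ (fun x => sol.u t ω x ^ ((n + 2) / 3)) w₂ ∧
        ThinFilm.HasWeakDeriv 3 Set.univ (fun x => sol.u t ω x ^ ((n + 2) / 2)) w₃ ∧
        ∀ ζ : ℝ → ℝ, Function.Periodic ζ L → (∃ K : ℝ≥0, LipschitzWith K ζ) →
          ∫⁻ x in Set.Ioo 0 L, ENNReal.ofReal (ζ x ^ 6 * |w₁ x| ^ 6) ≤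
              ThinFilm.bernisBound C n L ζ (sol.u t ω) (sol.uxxx t ω) ∧
          ∫⁻ x in Set.Ioo 0 L, ENNReal.ofReal (ζ x ^ 6 * |w₂ x| ^ 3) ≤
              ThinFilm.bernisBound C n L ζ (sol.u t ω) (sol.uxxx t ω) ∧
          ∫⁻ x in Set.Ioo 0 L, ENNReal.ofReal (ζ x ^ 6 * |w₃ x| ^ 2) ≤
              ThinFilm.bernisBound C n L ζ (sol.u t ω) (sol.uxxx t ω) := by
  obtain ⟨C, hC⟩ := ThinFilm.bernis_of_hasWeakDeriv hn
  refine ⟨C, fun L T δ γ S lam Λ hL _ _ hγ _ _ _ Ω mΩ P _ sol => ?_⟩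
  obtain ⟨K, -, hK⟩ := sol.hoelder
  filter_upwards [hK, sol.positive, sol.uxxx_weak] with ω hω hpos hweak
  filter_upwards [hpos, hweak] with t ht hwt
  -- Strict positivity turns the derivative on the positivity set into a global one.
  rw [show {x | 0 < sol.u t ω x} = Set.univ from Set.eq_univ_of_forall ht] at hwt
  have hcont : ContinuousOn (sol.u t ω) (Set.Icc 0 L) := by
    -- At equal times the temporal Hölder term is a positive power of 0.
    refine ThinFilm.continuousOn_of_hoelder (K := K ω) hγ.1 fun x hx y hy => ((hω t t x hx y hy).2).trans ?_
    have h0 : γ / 4 ≠ 0 := by linarith [hγ.1]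
    simp [Real.zero_rpow h0]
  exact hC L (sol.u t ω) (sol.uxxx t ω) hL
    (ThinFilm.continuous_of_periodic hL (sol.periodic t ω) hcont) (sol.periodic t ω) ht hwt
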